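/- Let $\Omega\subset\mathbb R^d$ be a nonempty open set of finite Lebesgue measure (for instance a bounded connected domain with smooth boundary). Let $R,T,\beta,\kappa,\tau,c_t>0$ and $\vartheta_0,\alpha\in\mathbb R$, let $c_m>0$, and let $c_M$ and $\epsilon_0$ be real numbers with $\beta c_M\le\epsilon_0<1$. Let $c^n:\Omega\to\mathbb R$ be measurable with $c_m\le c^n\le c_M$ almost everywhere in $\Omega$, and let $\lambda$ satisfy the concavity condition $$\lambda\ \ge\ \frac{\epsilon_0}{(1-\epsilon_0)^2}+\left(\frac{\epsilon_0^2}{(1-\epsilon_0)^4}-2\ln(1-\epsilon_0)\,\frac{\epsilon_0}{(1-\epsilon_0)^2}\right)^{1/2}.$$ Put $$G(c)=\sqrt{\lambda c-c\ln(1-\beta c)},\qquad \nu(c)=RT\Big(\frac1c+G'(c)^2\Big),$$ $$\mu_{\rm attraction}(c)=\frac{\alpha}{2\sqrt2\,\beta}\ln\!\left(\frac{1+(1-\sqrt2)\beta c}{1+(1+\sqrt2)\beta c}\right)-\frac{\alpha c}{1+2\beta c-(\beta c)^2},$$ $$s_r(c)=-\vartheta_0-RT\ln c+RT\big(G'(c)^2c-2G(c)G'(c)+\lambda\big)-\mu_{\rm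 attraction}(c).$$ Then the linear semi-discrete problem $$\frac{c^{n+1}-c^n}{\tau}-\kappa\Delta c^{n+1}+\nu(c^n)c^{n+1}=s_r(c^n)+\mu_e^{n+1}\ \text{ in }\Omega,\qquad \int_\Omega c^{n+1}\,dx=c_t,\qquad \nabla c^{n+1}\cdot n=0\ \text{ on }\partial\Omega$$ has a unique weak solution. That is, there is exactly one pair $(c^{n+1},\mu_e^{n+1})\in H^1(\Omega)\times\mathbb R$ (functions being identified when they agree almost everywhere) such that $\int_\Omega c^{n+1}\,dx=c_t$ and, for all $v\in H^1(\Omega)$, $$\frac1\tau\int_\Omega(c^{n+1}-c^n)v\,dx+\kappa\int_\Omega\nabla c^{n+1}\cdot\nabla v\,dx+\int_\Omega\nu(c^n)c^{n+1}v\,dx=\int_\Omega s_r(c^n)v\,dx+\int_\Omega\mu_e^{n+1}v\,dx.$$ In particular, there is exactly one $c^{n+1}\in H^1(\Omega)$ for which some $\mu_e^{n+1}\in\mathbb R$ satisfies these conditions. -/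

import Mathlib

open MeasureTheory
open scoped ContDiff

noncomputable section

namespace SemiDiscrete

/-! ### The Sobolev space `H¹(Ω)` -/

/-- The space `L²(Ω; F)` for a set `Ω ⊆ ℝᵈ` with Lebesgue measure. -/
abbrev L2 {d : ℕ} (Ω : Set (EuclideanSpace ℝ (Fin d))) (F : Type) [NormedAddCommGroup F] : Type :=
  Lp F 2 (volume.restrict Ω)

/-- `g ∈ L²(Ω; ℝᵈ)` is the weak gradient of `u ∈ L²(Ω)`: for every test function `φ ∈ C_c^∞(Ω)` and
every coordinate `i`, `∫_Ω u ∂ᵢφ = - ∫_Ω gᵢ φ`. -/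
def HasWeakGradient {d : ℕ} (Ω : Set (EuclideanSpace ℝ (Fin d)))
    (u : L2 Ω ℝ) (g : L2 Ω (EuclideanSpace ℝ (Fin d))) : Prop :=
  ∀ φ : EuclideanSpace ℝ (Fin d) → ℝ, ContDiff ℝ ∞ φ → HasCompactSupport φ → tsupport φ ⊆ Ω →
    ∀ i : Fin d,
      (∫ x in Ω, u x * fderiv ℝ φ x (EuclideanSpace.single i 1)) = - (∫ x in Ω, g x i * φ x)

/-! ### Coefficients of the linear semi-discrete scheme for the Peng–Robinson model -/

/-- The intermediate energy function `G(c) = √(λ c - c ln (1 - β c))`. -/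
def G (lam β c : ℝ) : ℝ := Real.sqrt (lam * c - c * Real.log (1 - β * c))

/-- The derivative `G'(c)` with respect to the molar density. -/
def G' (lam β c : ℝ) : ℝ := deriv (G lam β) c

/-- The attraction part of the chemical potential; `α` is the value `α(T)`. -/
def muAttraction (α β c : ℝ) : ℝ :=
  α / (2 * Real.sqrt 2 * β) *
      Real.log ((1 + (1 - Real.sqrt 2) * β * c) / (1 + (1 + Real.sqrt 2) * β * c))
    - α * c / (1 + 2 * β * c - (β * c) ^ 2)

/-- The coefficient `ν(c) = R T (1 / c + G'(c)²)`. -/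
def nu (R T β lam c : ℝ) : ℝ := R * T * (1 / c + G' lam β c ^ 2)

/-- The source term
`s_r(c) = -ϑ₀ - R T ln c + R T (G'(c)² c - 2 G(c) G'(c) + λ) - μ_attraction(c)`. -/
def sr (R T ϑ₀ α β lam c : ℝ) : ℝ :=
  -ϑ₀ - R * T * Real.log c
    + R * T * (G' lam β c ^ 2 * c - 2 * G lam β c * G' lam β c + lam)
    - muAttraction α β c

/-- `(c, μ)` is a weak solution of
`(c - cⁿ) / τ - κ Δc + ν(cⁿ) c = s_r(cⁿ) + μ` in `Ω`, `∫_Ω c = c_t`, `∇c · n = 0` on `∂Ω`: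
`c ∈ H¹(Ω)` has total mass `c_t`, `μ` is a real number, and the equation holds when tested with every
`v ∈ H¹(Ω)`; the Neumann condition is the natural boundary condition of this formulation.
In the definition `g = ∇c` and `h = ∇v`. -/
def IsWeakSolution {d : ℕ} (Ω : Set (EuclideanSpace ℝ (Fin d)))
    (R T ϑ₀ α β lam κ τ ct : ℝ) (cn : EuclideanSpace ℝ (Fin d) → ℝ)
    (c : L2 Ω ℝ) (μ : ℝ) : Prop :=
  (∃ g : L2 Ω (EuclideanSpace ℝ (Fin d)), HasWeakGradient Ω c g ∧
    ∀ (v : L2 Ω ℝ) (h : L2 Ω (EuclideanSpace ℝ (Fin d))), HasWeakGradient Ω v h →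
      (1 / τ) * (∫ x in Ω, (c x - cn x) * v x)
          + κ * (∫ x in Ω, inner ℝ (g x) (h x))
          + (∫ x in Ω, nu R T β lam (cn x) * c x * v x)
        = (∫ x in Ω, sr R T ϑ₀ α β lam (cn x) * v x) + (∫ x in Ω, μ * v x)) ∧
  (∫ x in Ω, c x) = ct

end SemiDiscrete

end

/-!
The bilinear form `τ⁻¹ ∫ u v + κ ∫ ∇u · ∇v + ∫ ν(cⁿ) u v` is bounded and coercive on `H¹(Ω)`: the
time step controls the `L²` norm, the diffusion controls the gradient, and `ν(cⁿ) ≥ 0`. Hence the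
regularity, connectedness or boundedness of `Ω` play no role, and Lax–Milgram applies as soon as
`ν(cⁿ)` and `s_r(cⁿ)` are essentially bounded. They are, because `cⁿ` takes its values in
`[cm, cM]`, a compact subset of `(0, 1/β)`, and all the coefficients are continuous there
(`continuousOn_nu`, `continuousOn_sr`); the concavity condition enters only through `lam > 0`,
which keeps the radicand of `G` positive.

The multiplier `μ` is found by superposition (`existsUnique_of_isCoercive`). If `u₁` solves the
problem with `μ = 0` and `u₂` the problem whose right-hand side is the total mass `l(v) = ∫ v`, the
solution is `u₁ + μ u₂` with `l(u₁) + μ l(u₂) = ct`, and `l(u₂) = B(u₂, u₂) > 0` because `l ≠ 0`: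
constants belong to `H¹(Ω)` (`hasWeakGradient_one`) and `Ω` has positive finite measure.

`H¹(Ω)` is realised as the closed graph of the weak gradient in `L² × L²` (`H1`, `isClosed_H1`), so
the argument never uses that a weak gradient is unique.
-/

noncomputable section

namespace SemiDiscrete

/-! ### Boundedness of the coefficients -/

/-- The logarithm in `G` contributes a nonnegative amount, so positivity of `lam` alone keeps the
radicand away from zero. -/
lemma G_radicand_pos {lam β c : ℝ} (hlam : 0 < lam) (hβ : 0 < β) (hc : 0 < c) (hβc : β * c < 1) :
    0 < lam * c - c * Real.log (1 - β * c) := by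
  have h1 : Real.log (1 - β * c) ≤ 0 :=
    Real.log_nonpos (by linarith) (by linarith [mul_pos hβ hc])
  nlinarith [mul_pos hlam hc, mul_nonneg hc.le (neg_nonneg.2 h1)]

lemma contDiffAt_G {lam β c : ℝ} (hlam : 0 < lam) (hβ : 0 < β) (hc : 0 < c) (hβc : β * c < 1) :
    ContDiffAt ℝ 1 (G lam β) c := by
  have h0 : (1 - β * c) ≠ 0 := by linarith
  unfold G
  refine ContDiffAt.sqrt ?_ (G_radicand_pos hlam hβ hc hβc).ne'
  have h1 : ContDiffAt ℝ 1 (fun c : ℝ => 1 - β * c) c := by fun_prop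
  exact (by fun_prop : ContDiffAt ℝ 1 (fun c : ℝ => lam * c) c).sub (contDiffAt_id.mul (h1.log h0))

lemma continuousOn_G' {lam β cm cM : ℝ} (hlam : 0 < lam) (hβ : 0 < β) (hcm : 0 < cm)
    (hcM : β * cM < 1) : ContinuousOn (G' lam β) (Set.Icc cm cM) := by
  have hU : IsOpen {c : ℝ | 0 < c ∧ β * c < 1} :=
    (isOpen_lt continuous_const continuous_id).inter
      (isOpen_lt (continuous_const.mul continuous_id) continuous_const)
  have h : ContDiffOn ℝ 1 (G lam β) {c : ℝ | 0 < c ∧ β * c < 1} :=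
    fun c hc => (contDiffAt_G hlam hβ hc.1 hc.2).contDiffWithinAt
  refine (h.continuousOn_deriv_of_isOpen hU le_rfl).mono fun c hc => ⟨hcm.trans_le hc.1, ?_⟩
  exact (mul_le_mul_of_nonneg_left hc.2 hβ.le).trans_lt hcM

lemma continuousOn_nu {R T lam β cm cM : ℝ} (hlam : 0 < lam) (hβ : 0 < β) (hcm : 0 < cm)
    (hcM : β * cM < 1) : ContinuousOn (nu R T β lam) (Set.Icc cm cM) := by
  have h0 : ∀ c ∈ Set.Icc cm cM, c ≠ 0 := fun c hc => (hcm.trans_le hc.1).ne'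
  unfold nu
  exact continuousOn_const.mul
    ((continuousOn_const.div continuousOn_id h0).add ((continuousOn_G' hlam hβ hcm hcM).pow 2))

lemma continuousOn_muAttraction {α β cm cM : ℝ} (hβ : 0 < β) (hcm : 0 < cm)
    (hcM : β * cM < 1) : ContinuousOn (muAttraction α β) (Set.Icc cm cM) := by
  have hy : ∀ c ∈ Set.Icc cm cM, 0 < β * c ∧ β * c < 1 := fun c hc =>
    ⟨mul_pos hβ (hcm.trans_le hc.1), (mul_le_mul_of_nonneg_left hc.2 hβ.le).trans_lt hcM⟩
  have hs0 : 0 ≤ Real.sqrt 2 := Real.sqrt_nonneg 2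
  have hs2 : Real.sqrt 2 < 2 := (Real.sqrt_lt' two_pos).2 (by norm_num)
  have hnum : ∀ c ∈ Set.Icc cm cM, 0 < 1 + (1 - Real.sqrt 2) * β * c := fun c hc => by
    nlinarith [hy c hc, mul_pos (hy c hc).1 (sub_pos.2 hs2)]
  have hden : ∀ c ∈ Set.Icc cm cM, 0 < 1 + (1 + Real.sqrt 2) * β * c := fun c hc => by
    nlinarith [hy c hc, mul_nonneg (hy c hc).1.le hs0]
  have hquad : ∀ c ∈ Set.Icc cm cM, 0 < 1 + 2 * β * c - (β * c) ^ 2 := fun c hc => by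
    nlinarith [hy c hc, mul_pos (hy c hc).1 (sub_pos.2 (hy c hc).2)]
  unfold muAttraction
  refine ContinuousOn.sub (continuousOn_const.mul (ContinuousOn.log ?_ ?_)) ?_
  · exact ContinuousOn.div (by fun_prop) (by fun_prop) fun c hc => (hden c hc).ne'
  · exact fun c hc => (div_pos (hnum c hc) (hden c hc)).ne'
  · exact ContinuousOn.div (by fun_prop) (by fun_prop) fun c hc => (hquad c hc).ne'

lemma continuousOn_sr {R T ϑ₀ α lam β cm cM : ℝ} (hlam : 0 < lam) (hβ : 0 < β) (hcm : 0 < cm)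
    (hcM : β * cM < 1) : ContinuousOn (sr R T ϑ₀ α β lam) (Set.Icc cm cM) := by
  have h0 : ∀ c ∈ Set.Icc cm cM, c ≠ 0 := fun c hc => (hcm.trans_le hc.1).ne'
  have hG' := continuousOn_G' hlam hβ hcm hcM
  have hG : ContinuousOn (G lam β) (Set.Icc cm cM) := fun c hc =>
    (contDiffAt_G hlam hβ (hcm.trans_le hc.1)
      ((mul_le_mul_of_nonneg_left hc.2 hβ.le).trans_lt hcM)).continuousAt.continuousWithinAt
  have hlog : ContinuousOn Real.log (Set.Icc cm cM) := Real.continuousOn_log.mono h0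
  have hatt := continuousOn_muAttraction (α := α) hβ hcm hcM
  unfold sr
  fun_prop

lemma measurable_nu (R T β lam : ℝ) : Measurable (nu R T β lam) := by
  have hG' : Measurable (G' lam β) := measurable_deriv _
  unfold nu
  fun_prop

lemma measurable_sr (R T ϑ₀ α β lam : ℝ) : Measurable (sr R T ϑ₀ α β lam) := by
  have hG' : Measurable (G' lam β) := measurable_deriv _
  have hG : Measurable (G lam β) := by unfold G; fun_prop
  have hatt : Measurable (muAttraction α β) := by unfold muAttraction; fun_prop
  unfold sr
  fun_prop

/-- A measurable function that is continuous on a compact interval turns essential bounds into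
essential bounds. -/
lemma memLp_top_comp {X : Type*} [MeasurableSpace X] {m : Measure X} {f : ℝ → ℝ} {u : X → ℝ}
    {a b : ℝ} (hf : Measurable f) (hfc : ContinuousOn f (Set.Icc a b))
    (hu : AEStronglyMeasurable u m) (hab : ∀ᵐ x ∂m, a ≤ u x ∧ u x ≤ b) :
    MemLp (fun x => f (u x)) ⊤ m := by
  obtain ⟨C, hC⟩ := isCompact_Icc.exists_bound_of_continuousOn hfc
  exact memLp_top_of_bound (hf.comp_aemeasurable hu.aemeasurable).aestronglyMeasurable C
    (hab.mono fun x hx => hC _ hx)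

/-! ### Coercive problems with one linear constraint -/

/-- A coercive problem with right-hand side known up to a multiple of `l`, the multiple being fixed
by the value of `l` on the solution. -/
lemma existsUnique_of_isCoercive {V : Type*} [NormedAddCommGroup V] [InnerProductSpace ℝ V]
    [CompleteSpace V] {B : V →L[ℝ] V →L[ℝ] ℝ} (hB : IsCoercive B) (F l : V →L[ℝ] ℝ) (hl : l ≠ 0)
    (m : ℝ) : ∃! p : V × ℝ, (∀ v, B p.1 v = F v + p.2 * l v) ∧ l p.1 = m := by
  have hsolve : ∀ f : V →L[ℝ] ℝ, ∃ u, ∀ v, B u v = f v := fun f => by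
    refine ⟨hB.continuousLinearEquivOfBilin.symm ((InnerProductSpace.toDual ℝ V).symm f),
      fun v => ?_⟩
    rw [← hB.continuousLinearEquivOfBilin_apply]
    simp
  have hzero : ∀ u, B u u = 0 → u = 0 := fun u hu => by
    obtain ⟨C, hC, h⟩ := hB
    have h1 : C * (‖u‖ * ‖u‖) ≤ 0 := by linarith [h u]
    have h2 : ‖u‖ * ‖u‖ ≤ 0 := nonpos_of_mul_nonpos_right h1 hC
    simpa using le_antisymm h2 (mul_self_nonneg _)
  obtain ⟨u₁, h₁⟩ := hsolve F
  obtain ⟨u₂, h₂⟩ := hsolve l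
  -- `l u₂ = B u₂ u₂`, which vanishes only if `u₂ = 0`, that is, only if `l = 0`.
  have hlu : l u₂ ≠ 0 := fun h => hl <| by
    have h0 := hzero u₂ ((h₂ u₂).trans h)
    ext v
    simp [← h₂ v, h0]
  refine ⟨(u₁ + ((m - l u₁) / l u₂) • u₂, (m - l u₁) / l u₂), ⟨fun v => ?_, ?_⟩, ?_⟩
  · simp [h₁, h₂]
  · simp only [map_add, map_smul, smul_eq_mul]
    field_simp
    ring
  · rintro ⟨u, r⟩ ⟨hu, hm⟩
    simp only at hu hm
    set t := (m - l u₁) / l u₂ with ht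
    have ht' : t * l u₂ = m - l u₁ := by rw [ht]; field_simp
    have hd : ∀ v, B (u - (u₁ + t • u₂)) v = (r - t) * l v := fun v => by
      simp [h₁, h₂, hu]
      ring
    have hld : l (u - (u₁ + t • u₂)) = 0 := by
      simp only [map_sub, map_add, map_smul, smul_eq_mul, hm]
      linarith
    have h0 : u - (u₁ + t • u₂) = 0 := hzero _ (by rw [hd, hld, mul_zero])
    have hrt : (r - t) * l u₂ = 0 := by rw [← hd, h0]; simp
    have hrt' : r = t := sub_eq_zero.1 ((mul_eq_zero.1 hrt).resolve_right hlu)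
    rw [Prod.mk.injEq]
    exact ⟨sub_eq_zero.1 h0, hrt'⟩

/-! ### The graph of the weak gradient -/

section Sobolev

variable {d : ℕ} {Ω : Set (EuclideanSpace ℝ (Fin d))}

lemma integral_mul_eq_inner {X : Type*} [MeasurableSpace X] {m : Measure X} (u v : Lp ℝ 2 m) :
    ∫ x, u x * v x ∂m = inner ℝ u v := by
  simp [L2.inner_def, mul_comm]

lemma integral_mul_eq_inner_toLp {X : Type*} [MeasurableSpace X] {m : Measure X} {f : X → ℝ}
    (hf : MemLp f 2 m) (v : Lp ℝ 2 m) : ∫ x, f x * v x ∂m = inner ℝ (hf.toLp f) v := by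
  rw [← integral_mul_eq_inner]
  exact integral_congr_ae (hf.coeFn_toLp.mono fun x hx => by simp [hx])

lemma memLp_of_hasCompactSupport {E : Type*} [NormedAddCommGroup E]
    {f : EuclideanSpace ℝ (Fin d) → E} (hf : Continuous f) (hc : HasCompactSupport f) :
    MemLp f 2 (volume.restrict Ω) :=
  (hf.memLp_of_hasCompactSupport hc).restrict Ω

/-- For a fixed test function and coordinate, the identity defining the weak gradient says that a
continuous linear functional of the pair `(u, g)` vanishes. -/
lemma exists_inner_eq_weakGradient_defect {φ : EuclideanSpace ℝ (Fin d) → ℝ}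
    (hφ : ContDiff ℝ ∞ φ) (hc : HasCompactSupport φ) (i : Fin d) :
    ∃ (a : L2 Ω ℝ) (b : L2 Ω (EuclideanSpace ℝ (Fin d))),
      ∀ (u : L2 Ω ℝ) (g : L2 Ω (EuclideanSpace ℝ (Fin d))),
        (∫ x in Ω, u x * fderiv ℝ φ x (EuclideanSpace.single i 1)) + (∫ x in Ω, g x i * φ x)
          = inner ℝ a u + inner ℝ b g := by
  have ha : MemLp (fun x => fderiv ℝ φ x (EuclideanSpace.single i 1)) 2 (volume.restrict Ω) :=
    memLp_of_hasCompactSupport ((hφ.continuous_fderiv (by simp)).clm_apply continuous_const)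
      (hc.fderiv_apply ℝ _)
  have hb : MemLp (fun x => φ x • EuclideanSpace.single i (1 : ℝ)) 2 (volume.restrict Ω) :=
    memLp_of_hasCompactSupport (hφ.continuous.smul continuous_const) hc.smul_right
  refine ⟨ha.toLp _, hb.toLp _, fun u g => ?_⟩
  congr 1
  · rw [← integral_mul_eq_inner_toLp ha]
    simp only [mul_comm]
  · rw [L2.inner_def]
    refine integral_congr_ae (hb.coeFn_toLp.mono fun x hx => ?_)
    simp only [hx]
    simp [inner_smul_left, EuclideanSpace.inner_single_left, mul_comm]

variable (Ω) in
/-- `H¹(Ω)`, encoded as the graph of the weak gradient inside the Hilbert space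
`L²(Ω) × L²(Ω; ℝᵈ)`, from which it inherits the usual inner product. -/
def H1 : Submodule ℝ (WithLp 2 (L2 Ω ℝ × L2 Ω (EuclideanSpace ℝ (Fin d)))) where
  carrier := {x | HasWeakGradient Ω x.fst x.snd}
  zero_mem' := fun φ hφ hc _ i => by
    obtain ⟨a, b, h⟩ := exists_inner_eq_weakGradient_defect (Ω := Ω) hφ hc i
    have h0 := h 0 0
    simp only [inner_zero_right, add_zero] at h0
    exact eq_neg_of_add_eq_zero_left h0
  add_mem' := fun {x y} hx hy φ hφ hc hs i => by
    obtain ⟨a, b, h⟩ := exists_inner_eq_weakGradient_defect (Ω := Ω) hφ hc i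
    have h1 := hx φ hφ hc hs i
    have h2 := hy φ hφ hc hs i
    have h3 := h (x.fst + y.fst) (x.snd + y.snd)
    rw [inner_add_right, inner_add_right] at h3
    have e : (x + y).fst = x.fst + y.fst ∧ (x + y).snd = x.snd + y.snd := ⟨rfl, rfl⟩
    rw [e.1, e.2]
    linarith [h x.fst x.snd, h y.fst y.snd]
  smul_mem' := fun r x hx φ hφ hc hs i => by
    obtain ⟨a, b, h⟩ := exists_inner_eq_weakGradient_defect (Ω := Ω) hφ hc i
    have h1 := h x.fst x.snd
    rw [hx φ hφ hc hs i, neg_add_cancel] at h1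
    have h3 := h (r • x.fst) (r • x.snd)
    rw [inner_smul_right, inner_smul_right, ← mul_add, ← h1, mul_zero] at h3
    exact eq_neg_of_add_eq_zero_left h3

lemma isClosed_H1 :
    IsClosed (H1 Ω : Set (WithLp 2 (L2 Ω ℝ × L2 Ω (EuclideanSpace ℝ (Fin d))))) := by
  have : (H1 Ω : Set (WithLp 2 (L2 Ω ℝ × L2 Ω (EuclideanSpace ℝ (Fin d))))) =
      {x | HasWeakGradient Ω x.fst x.snd} := rfl
  rw [this]
  simp only [HasWeakGradient, Set.ofPred_forall]
  refine isClosed_iInter fun φ => isClosed_iInter fun hφ => isClosed_iInter fun hc =>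
    isClosed_iInter fun _ => isClosed_iInter fun i => ?_
  obtain ⟨a, b, h⟩ := exists_inner_eq_weakGradient_defect (Ω := Ω) hφ hc i
  simp only [eq_neg_iff_add_eq_zero, h]
  have h1 : Continuous fun x : WithLp 2 (L2 Ω ℝ × L2 Ω (EuclideanSpace ℝ (Fin d))) => x.fst :=
    (WithLp.fstL 2 ℝ _ _).continuous
  have h2 : Continuous fun x : WithLp 2 (L2 Ω ℝ × L2 Ω (EuclideanSpace ℝ (Fin d))) => x.snd :=
    (WithLp.sndL 2 ℝ _ _).continuous
  exact isClosed_eq ((continuous_const.inner h1).add (continuous_const.inner h2)) continuous_const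

instance : CompleteSpace (H1 Ω) := isClosed_H1.completeSpace_coe

/-- Constants have weak gradient zero, because the derivative of a test function integrates to
zero. -/
lemma hasWeakGradient_one (hone : MemLp (fun _ => (1 : ℝ)) 2 (volume.restrict Ω)) :
    HasWeakGradient Ω (hone.toLp _) 0 := fun φ hφ hc hs i => by
  have hD : Continuous fun x => fderiv ℝ φ x (EuclideanSpace.single i 1) :=
    (hφ.continuous_fderiv (by simp)).clm_apply continuous_const
  have hzero : ∫ x, fderiv ℝ φ x (EuclideanSpace.single i 1) = 0 := by
    have := integral_mul_fderiv_eq_neg_fderiv_mul_of_integrable (μ := volume)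
      (f := fun _ : EuclideanSpace ℝ (Fin d) => (1 : ℝ)) (g := φ)
      (v := EuclideanSpace.single i 1) (by simp)
      (by simpa using hD.integrable_of_hasCompactSupport (hc.fderiv_apply ℝ _))
      (by simpa using hφ.continuous.integrable_of_hasCompactSupport hc)
      (fun _ _ => differentiableAt_const 1)
      (fun x _ => hφ.differentiable (by simp) x)
    simpa using this
  have hl : ∫ x in Ω, hone.toLp _ x * fderiv ℝ φ x (EuclideanSpace.single i 1) = 0 := by
    rw [integral_congr_ae (hone.coeFn_toLp.mono fun x hx => by rw [hx])]
    simp only [one_mul]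
    rw [setIntegral_eq_integral_of_forall_compl_eq_zero, hzero]
    intro x hx
    rw [fderiv_of_notMem_tsupport (𝕜 := ℝ) fun h => hx (hs h)]
    simp
  have hr : ∫ x in Ω, (0 : L2 Ω (EuclideanSpace ℝ (Fin d))) x i * φ x = 0 := by
    rw [← integral_zero (EuclideanSpace ℝ (Fin d)) ℝ (μ := volume.restrict Ω)]
    refine integral_congr_ae ((Lp.coeFn_zero (EuclideanSpace ℝ (Fin d)) 2
      (volume.restrict Ω)).mono fun x hx => ?_)
    simp only [hx]
    simp
  rw [hl, hr, neg_zero]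

variable (Ω) in
/-- The embedding `H¹(Ω) → L²(Ω)`. -/
def valL : H1 Ω →L[ℝ] L2 Ω ℝ := (WithLp.fstL 2 ℝ _ _).comp (H1 Ω).subtypeL

variable (Ω) in
/-- The weak gradient as an operator `H¹(Ω) → L²(Ω; ℝᵈ)`. -/
def gradL : H1 Ω →L[ℝ] L2 Ω (EuclideanSpace ℝ (Fin d)) :=
  (WithLp.sndL 2 ℝ _ _).comp (H1 Ω).subtypeL

lemma norm_sq_H1 (x : H1 Ω) : ‖x‖ ^ 2 = ‖valL Ω x‖ ^ 2 + ‖gradL Ω x‖ ^ 2 :=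
  WithLp.prod_norm_sq_eq_of_L2 (x : WithLp 2 (L2 Ω ℝ × L2 Ω (EuclideanSpace ℝ (Fin d))))

lemma valL_mk {u : L2 Ω ℝ} {g : L2 Ω (EuclideanSpace ℝ (Fin d))} (h : HasWeakGradient Ω u g) :
    valL Ω ⟨WithLp.toLp 2 (u, g), h⟩ = u := rfl

lemma gradL_mk {u : L2 Ω ℝ} {g : L2 Ω (EuclideanSpace ℝ (Fin d))} (h : HasWeakGradient Ω u g) :
    gradL Ω ⟨WithLp.toLp 2 (u, g), h⟩ = g := rfl

lemma hasWeakGradient_valL_gradL (x : H1 Ω) : HasWeakGradient Ω (valL Ω x) (gradL Ω x) := x.2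

/-! ### The bilinear form of the scheme -/

/-- Multiplication by an essentially bounded function, as an operator on `L²(Ω)`. -/
def mulL (a : Lp ℝ ⊤ (volume.restrict Ω)) : L2 Ω ℝ →L[ℝ] L2 Ω ℝ :=
  (ContinuousLinearMap.mul ℝ ℝ).holderL (volume.restrict Ω) ⊤ 2 2 a

lemma inner_mulL_toLp {f : EuclideanSpace ℝ (Fin d) → ℝ} (hf : MemLp f ⊤ (volume.restrict Ω))
    (u v : L2 Ω ℝ) : inner ℝ (mulL (hf.toLp f) u) v = ∫ x in Ω, f x * u x * v x := by
  rw [← integral_mul_eq_inner]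
  refine integral_congr_ae ?_
  filter_upwards [hf.coeFn_toLp,
    (ContinuousLinearMap.mul ℝ ℝ).coeFn_holder (r := 2) (hf.toLp f) u] with x h1 h2
  have h3 : mulL (hf.toLp f) u x = f x * u x := h2.trans (by simp [h1])
  rw [h3]

/-- The bilinear form `τ⁻¹ ∫ u v + κ ∫ ∇u · ∇v + ∫ a u v` on `H¹(Ω)`. -/
def schemeForm (τ κ : ℝ) (a : Lp ℝ ⊤ (volume.restrict Ω)) : H1 Ω →L[ℝ] H1 Ω →L[ℝ] ℝ :=
  (1 / τ) • (innerSL ℝ).bilinearComp (valL Ω) (valL Ω)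
    + κ • (innerSL ℝ).bilinearComp (gradL Ω) (gradL Ω)
    + (innerSL ℝ).bilinearComp ((mulL a).comp (valL Ω)) (valL Ω)

lemma schemeForm_apply (τ κ : ℝ) (a : Lp ℝ ⊤ (volume.restrict Ω)) (x y : H1 Ω) :
    schemeForm τ κ a x y = (1 / τ) * inner ℝ (valL Ω x) (valL Ω y)
      + κ * inner ℝ (gradL Ω x) (gradL Ω y) + inner ℝ (mulL a (valL Ω x)) (valL Ω y) := by
  simp [schemeForm]

/-- The time step already controls the `L²` norm, so a nonnegative coefficient `a` suffices, and no
Poincaré inequality is needed. -/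
lemma isCoercive_schemeForm {τ κ : ℝ} (hτ : 0 < τ) (hκ : 0 < κ)
    {f : EuclideanSpace ℝ (Fin d) → ℝ} (hf : MemLp f ⊤ (volume.restrict Ω))
    (h0 : ∀ᵐ x ∂(volume.restrict Ω), 0 ≤ f x) : IsCoercive (schemeForm τ κ (hf.toLp f)) := by
  refine ⟨min (1 / τ) κ, lt_min (by positivity) hκ, fun x => ?_⟩
  have hpos : 0 ≤ inner ℝ (mulL (hf.toLp f) (valL Ω x)) (valL Ω x) := by
    rw [inner_mulL_toLp]
    refine integral_nonneg_of_ae (h0.mono fun y hy => ?_)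
    simp only [mul_assoc]
    exact mul_nonneg hy (mul_self_nonneg _)
  rw [schemeForm_apply, mul_assoc, ← sq, norm_sq_H1, real_inner_self_eq_norm_sq,
    real_inner_self_eq_norm_sq, mul_add]
  have h1 := mul_le_mul_of_nonneg_right (min_le_left (1 / τ) κ) (sq_nonneg ‖valL Ω x‖)
  have h2 := mul_le_mul_of_nonneg_right (min_le_right (1 / τ) κ) (sq_nonneg ‖gradL Ω x‖)
  linarith

end Sobolev

/-! ### The weak problem as a constrained coercive problem -/

section WeakProblem

variable {d : ℕ} {Ω : Set (EuclideanSpace ℝ (Fin d))}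

/-- Any weak gradient of `c` witnessing the equation gives a point of `H¹(Ω)` above `c`, so weak
solutions are exactly the images of solutions of the constrained problem for `schemeForm`. -/
lemma isWeakSolution_iff {R T ϑ₀ α β lam κ τ ct : ℝ}
    {cn : EuclideanSpace ℝ (Fin d) → ℝ} (hcn : MemLp cn 2 (volume.restrict Ω))
    (hnu : MemLp (fun x => nu R T β lam (cn x)) ⊤ (volume.restrict Ω))
    (hsr : MemLp (fun x => sr R T ϑ₀ α β lam (cn x)) 2 (volume.restrict Ω))
    (hone : MemLp (fun _ => (1 : ℝ)) 2 (volume.restrict Ω))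
    (c : L2 Ω ℝ) (μ : ℝ) :
    IsWeakSolution Ω R T ϑ₀ α β lam κ τ ct cn c μ ↔
      ∃ x : H1 Ω, valL Ω x = c ∧
        (∀ y, schemeForm τ κ (hnu.toLp _) x y
          = (innerSL ℝ (hsr.toLp _ + (1 / τ) • hcn.toLp _)).comp (valL Ω) y
            + μ * (innerSL ℝ (hone.toLp _)).comp (valL Ω) y) ∧
        (innerSL ℝ (hone.toLp _)).comp (valL Ω) x = ct := by
  have hsub : ∀ v : L2 Ω ℝ, ∫ x in Ω, (c x - cn x) * v x
      = inner ℝ c v - inner ℝ (hcn.toLp cn) v := fun v => by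
    rw [← inner_sub_left, ← integral_mul_eq_inner]
    refine integral_congr_ae ?_
    filter_upwards [Lp.coeFn_sub c (hcn.toLp cn), hcn.coeFn_toLp] with x h1 h2
    rw [h1, Pi.sub_apply, h2]
  have hmass : ∫ x in Ω, c x = inner ℝ (hone.toLp _) c := by
    rw [← integral_mul_eq_inner_toLp hone]
    simp
  have hmul : ∀ v : L2 Ω ℝ, ∫ x in Ω, μ * v x = μ * inner ℝ (hone.toLp _) v := fun v => by
    rw [integral_const_mul, ← integral_mul_eq_inner_toLp hone]
    simp
  unfold IsWeakSolution
  simp only [hsub, hmul, hmass, ← L2.inner_def, ← inner_mulL_toLp hnu,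
    integral_mul_eq_inner_toLp hsr, schemeForm_apply, ContinuousLinearMap.comp_apply,
    innerSL_apply_apply, inner_add_left, real_inner_smul_left]
  constructor
  · rintro ⟨⟨g, hg, heq⟩, hm⟩
    refine ⟨⟨WithLp.toLp 2 (c, g), hg⟩, rfl, fun y => ?_, hm⟩
    rw [valL_mk, gradL_mk]
    linarith [heq (valL Ω y) (gradL Ω y) (hasWeakGradient_valL_gradL y)]
  · rintro ⟨x, rfl, heq, hm⟩
    refine ⟨⟨gradL Ω x, hasWeakGradient_valL_gradL x, fun v h hv => ?_⟩, hm⟩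
    have := heq ⟨WithLp.toLp 2 (v, h), hv⟩
    rw [valL_mk, gradL_mk] at this
    linarith

end WeakProblem

end SemiDiscrete

end

theorem theorem4p1 {d : ℕ} (Ω : Set (EuclideanSpace ℝ (Fin d)))
    (hΩ_open : IsOpen Ω) (hΩ_nonempty : Ω.Nonempty) (hΩ_finite : volume Ω ≠ ⊤)
    (R T ϑ₀ α β lam κ τ ct cm cM ε₀ : ℝ)
    (hR : 0 < R) (hT : 0 < T) (hβ : 0 < β) (hκ : 0 < κ) (hτ : 0 < τ) (hct : 0 < ct)
    (hcm : 0 < cm) (hcM : β * cM ≤ ε₀) (hε₀ : ε₀ < 1)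
    (hlam : ε₀ / (1 - ε₀) ^ 2
        + Real.sqrt (ε₀ ^ 2 / (1 - ε₀) ^ 4 - 2 * Real.log (1 - ε₀) * (ε₀ / (1 - ε₀) ^ 2)) ≤ lam)
    (cn : EuclideanSpace ℝ (Fin d) → ℝ)
    (hcn_meas : AEStronglyMeasurable cn (volume.restrict Ω))
    (hcn : ∀ᵐ x ∂(volume.restrict Ω), cm ≤ cn x ∧ cn x ≤ cM) :
    ∃! p : SemiDiscrete.L2 Ω ℝ × ℝ,
      SemiDiscrete.IsWeakSolution Ω R T ϑ₀ α β lam κ τ ct cn p.1 p.2 := by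
  have hfin : IsFiniteMeasure (volume.restrict Ω) := isFiniteMeasure_restrict.2 hΩ_finite
  have hvol : volume Ω ≠ 0 := (hΩ_open.measure_pos volume hΩ_nonempty).ne'
  have hne : (ae (volume.restrict Ω)).NeBot := by
    rw [ae_neBot]
    exact fun h => hvol (Measure.restrict_eq_zero.1 h)
  obtain ⟨x₀, hx₀⟩ := hcn.exists
  have hε₀_pos : 0 < ε₀ :=
    (mul_pos hβ (hcm.trans_le (hx₀.1.trans hx₀.2))).trans_le hcM
  have hlam_pos : 0 < lam := by
    have h1 : 0 < 1 - ε₀ := by linarith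
    refine lt_of_lt_of_le ?_ hlam
    positivity
  have hβcM : β * cM < 1 := hcM.trans_lt hε₀
  have hnu := SemiDiscrete.memLp_top_comp (SemiDiscrete.measurable_nu R T β lam)
    (SemiDiscrete.continuousOn_nu hlam_pos hβ hcm hβcM) hcn_meas hcn
  have hsr := (SemiDiscrete.memLp_top_comp (SemiDiscrete.measurable_sr R T ϑ₀ α β lam)
    (SemiDiscrete.continuousOn_sr hlam_pos hβ hcm hβcM) hcn_meas hcn).mono_exponent
    (le_top (a := 2))
  have hcn2 := (SemiDiscrete.memLp_top_comp measurable_id continuousOn_id hcn_meas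
    hcn).mono_exponent (le_top (a := 2))
  have hone : MemLp (fun _ => (1 : ℝ)) 2 (volume.restrict Ω) := memLp_const 1
  have hnu_nonneg : ∀ᵐ x ∂(volume.restrict Ω), 0 ≤ SemiDiscrete.nu R T β lam (cn x) :=
    hcn.mono fun x hx => by
      have : 0 < cn x := hcm.trans_le hx.1
      unfold SemiDiscrete.nu
      positivity
  -- The total mass is a nonzero functional on `H¹(Ω)`, since it is positive on constants.
  have hmass : (innerSL ℝ (hone.toLp _)).comp (SemiDiscrete.valL Ω) ≠ 0 := fun h => by
    have h1 := DFunLike.congr_fun h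
      ⟨WithLp.toLp 2 (hone.toLp _, 0), SemiDiscrete.hasWeakGradient_one hone⟩
    rw [ContinuousLinearMap.comp_apply, SemiDiscrete.valL_mk, innerSL_apply_apply,
      ← SemiDiscrete.integral_mul_eq_inner_toLp hone, _root_.zero_apply,
      integral_congr_ae (hone.coeFn_toLp.mono fun x hx => by rw [hx])] at h1
    simp [measureReal_def, ENNReal.toReal_eq_zero_iff, hvol, hΩ_finite] at h1
  obtain ⟨⟨x, μ⟩, hx, huniq⟩ := SemiDiscrete.existsUnique_of_isCoercive
    (SemiDiscrete.isCoercive_schemeForm hτ hκ hnu hnu_nonneg)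
    ((innerSL ℝ (hsr.toLp _ + (1 / τ) • hcn2.toLp _)).comp (SemiDiscrete.valL Ω))
    ((innerSL ℝ (hone.toLp _)).comp (SemiDiscrete.valL Ω)) hmass ct
  refine ⟨(SemiDiscrete.valL Ω x, μ),
    (SemiDiscrete.isWeakSolution_iff hcn2 hnu hsr hone _ _).2 ⟨x, rfl, hx.1, hx.2⟩, ?_⟩
  rintro ⟨c, r⟩ hc
  obtain ⟨y, rfl, hy⟩ := (SemiDiscrete.isWeakSolution_iff hcn2 hnu hsr hone _ _).1 hc
  have hyx := huniq (y, r) hy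
  rw [Prod.mk.injEq] at hyx
  rw [hyx.1, hyx.2]
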